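/- Let $S$ be a finite set and for each $\lambda>0$ let $Q(\lambda)=(q_{ij}(\lambda))_{i,j\in S}$ be an irreducible transition rate matrix on $S$ (nonnegative off-diagonal entries, zero row sums). Put $q_i(\lambda)=-q_{ii}(\lambda)$, and let $\Omega(\lambda)=(\omega_{ij}(\lambda))$ be the transition matrix of the jump chain: $\omega_{ij}(\lambda)=q_{ij}(\lambda)/q_i(\lambda)$ for $i\ne j$ and $\omega_{ii}(\lambda)=0$. Assume that for all $i\neq j$ the limit $\lim_{\lambda\to\infty}q_{ij}(\lambda)$ exists in $[0,\infty]$ and the limit $\lim_{\lambda\to\infty}\omega_{ij}(\lambda)$ exists. Let $A$ (the fast states) be the set of $i\in S$ with $q_i:=\lim_{\lambda\to\infty}q_i(\lambda)=\infty$ and $B=S\setminus A$ (the slow states) the set of $i$ with $q_i<\infty$; assume $B\neq\emptyset$ and $q_i>0$ for all $i\in B$. Put $Q=\lim_{\lambda\to\infty}Q(\lambda)$ and $\Omega=\lim_{\lambda\to\infty}\Omega(\lambda)$ entrywise, write $Q_{BA},Q_{BB}$ (whose entries are finite) and $\Omega_{AA},\Omega_{AB}$ for their blocks, and assume that the discrete-time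 Markov chain with transition matrix $\Omega$ started at any $i\in A$ reaches $B$ in finite time almost surely. (Then $I-\Omega_{AA}$ is invertible and $\Gamma=Q_{BB}+Q_{BA}(I-\Omega_{AA})^{-1}\Omega_{AB}$ is a transition rate matrix on $B$.) Let $\pi=(\pi_A,\pi_B)$ be any probability distribution on $S$ and set $\gamma(\pi)=\pi_B+\pi_A(I-\Omega_{AA})^{-1}\Omega_{AB}$, a probability distribution on $B$. Let $X=(X_t)_{t\ge0}$ be, under $P^\lambda_\pi$, the continuous-time Markov chain on $S$ with transition rate matrix $Q(\lambda)$ and initial distribution $\pi$, and let $Y=(Y_t)_{t\ge0}$ be, under $P_{\gamma(\pi)}$, the continuous-time Markov chain on $B$ with transition rate matrix $\Gamma$ and initial distribution $\gamma(\pi)$. Then for all $0<h<T$, $$\lim_{\lambda\to\infty}\ \sup_{h\le t\le T} d_{TV}\bigl(P^\lambda_\pi(X_t\in\cdot),\,P_{\gamma(\pi)}(Y_t\in\cdot)\bigr)=0,$$ where $d_{TV}(\mu,\nu)=\frac12\sum_{i\in S}|\mu_i-\nu_i|$ and the law of $Y_t$ is regarded as a probability distribution on $S$ concentrated on $B$.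 -/

import Mathlib

open MeasureTheory Filter Topology
open scoped NNReal

namespace TwoTimeScale

/-! ### Markov chains on a finite state space -/

section Chains

variable {E : Type*} [Fintype E] [DecidableEq E]

/-- `Q` is a transition rate matrix: the off-diagonal entries are nonnegative and every row sums
to zero. -/
structure IsRateMatrix (Q : Matrix E E ℝ) : Prop where
  nonneg : ∀ i j, i ≠ j → 0 ≤ Q i j
  row_sum : ∀ i, ∑ j, Q i j = 0

/-- A rate matrix is irreducible when every state leads to every other one through transitions of
positive rate. -/
def IsIrreducibleRate (Q : Matrix E E ℝ) : Prop :=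
  ∀ i j, Relation.ReflTransGen (fun k l => k ≠ l ∧ 0 < Q k l) i j

/-- Transition probability matrix of the jump chain: `ω i j = q i j / q i` for `i ≠ j`, where
`q i = - q i i`, and `ω i i = 0`. -/
noncomputable def jumpMatrix (Q : Matrix E E ℝ) : Matrix E E ℝ :=
  Matrix.of fun i j => if i = j then 0 else Q i j / (-Q i i)

/-- Under the measure `P`, the process `ξ` is a discrete-time Markov chain with transition
probability matrix `W` and initial distribution `μ`. -/
structure IsDiscreteMarkovChain {Ω : Type*} [MeasurableSpace Ω] [MeasurableSpace E]
    (W : Matrix E E ℝ) (μ : E → ℝ) (ξ : ℕ → Ω → E) (P : Measure Ω) : Prop where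
  isProb : IsProbabilityMeasure P
  measurable : ∀ n, Measurable (ξ n)
  initial : ∀ i, P.real {ω | ξ 0 ω = i} = μ i
  markov : ∀ (n : ℕ) (i : ℕ → E),
    P.real {ω | ∀ k ≤ n + 1, ξ k ω = i k} =
      P.real {ω | ∀ k ≤ n, ξ k ω = i k} * W (i n) (i (n + 1))

/-- Under the measure `P`, the process `X` is a (right-continuous) continuous-time Markov chain
with transition rate matrix `Q` and initial distribution `μ`; its transition probabilities over a
time `s` are the entries of the matrix exponential of `s • Q`. -/
structure IsMarkovChain {Ω : Type*} [MeasurableSpace Ω] [MeasurableSpace E]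
    (Q : Matrix E E ℝ) (μ : E → ℝ) (X : ℝ≥0 → Ω → E) (P : Measure Ω) : Prop where
  isProb : IsProbabilityMeasure P
  measurable : ∀ t, Measurable (X t)
  rightCont : ∀ ω t, ∀ᶠ s in 𝓝[≥] t, X s ω = X t ω
  initial : ∀ i, P.real {ω | X 0 ω = i} = μ i
  markov : ∀ (n : ℕ) (t : ℕ → ℝ≥0), Monotone t → ∀ i : ℕ → E,
    P.real {ω | ∀ k ≤ n + 1, X (t k) ω = i k} =
      P.real {ω | ∀ k ≤ n, X (t k) ω = i k} *
        NormedSpace.exp (((t (n + 1) : ℝ) - (t n : ℝ)) • Q) (i n) (i (n + 1))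

/-- Total variation distance between two distributions on a finite space. -/
noncomputable def tvDist [MeasurableSpace E] (μ ν : Measure E) : ℝ :=
  (1 / 2) * ∑ i, |μ.real {i} - ν.real {i}|

end Chains

/-! ### Chains with two time scales and their reduction -/

section Reduction

variable {S : Type*} [Fintype S] [DecidableEq S]

/-- The exit rate `q i (l) = - q i i (l)` of the state `i`, as a function of the parameter. -/
def exitRate (Q : ℝ → Matrix S S ℝ) (i : S) (l : ℝ) : ℝ := -Q l i i

open Classical in
/-- The set `A` of fast states: those whose exit rate tends to infinity. -/
noncomputable def fastStates (Q : ℝ → Matrix S S ℝ) : Finset S :=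
  {i | Tendsto (exitRate Q i) atTop atTop}

open Classical in
/-- The set `B` of slow states: those whose exit rate has a finite limit. -/
noncomputable def slowStates (Q : ℝ → Matrix S S ℝ) : Finset S :=
  {i | ∃ c : ℝ, Tendsto (exitRate Q i) atTop (𝓝 c)}

/-- The standing assumptions on the family of transition rate matrices `Q l`, `l > 0`. -/
structure IsTwoTimeScale (Q : ℝ → Matrix S S ℝ) : Prop where
  rate : ∀ l, 0 < l → IsRateMatrix (Q l)
  irreducible : ∀ l, 0 < l → IsIrreducibleRate (Q l)
  rate_limit : ∀ i j, i ≠ j →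
    (∃ c : ℝ, Tendsto (fun l => Q l i j) atTop (𝓝 c)) ∨ Tendsto (fun l => Q l i j) atTop atTop
  jump_limit : ∀ i j, i ≠ j → ∃ c : ℝ, Tendsto (fun l => jumpMatrix (Q l) i j) atTop (𝓝 c)
  slow_nonempty : (slowStates Q).Nonempty
  slow_pos : ∀ i ∈ slowStates Q, ∀ c : ℝ, Tendsto (exitRate Q i) atTop (𝓝 c) → 0 < c

/-- The entrywise limit of `Q l` as `l → ∞`. Only its rows at slow states, where all the limits
are finite, are ever used. -/
noncomputable def limRate (Q : ℝ → Matrix S S ℝ) : Matrix S S ℝ :=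
  Matrix.of fun i j => limUnder atTop fun l => Q l i j

/-- The entrywise limit of the transition matrices of the jump chains as `l → ∞`. -/
noncomputable def limJump (Q : ℝ → Matrix S S ℝ) : Matrix S S ℝ :=
  Matrix.of fun i j => limUnder atTop fun l => jumpMatrix (Q l) i j

/-- The block of the matrix `M` with rows in `C` and columns in `D`. -/
def block (M : Matrix S S ℝ) (C D : Finset S) : Matrix C D ℝ :=
  M.submatrix Subtype.val Subtype.val

/-- The matrix `(I - Ω_AA)⁻¹ Ω_AB`. -/
noncomputable def exitMatrix (Q : ℝ → Matrix S S ℝ) : Matrix (fastStates Q) (slowStates Q) ℝ :=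
  (1 - block (limJump Q) (fastStates Q) (fastStates Q))⁻¹ *
    block (limJump Q) (fastStates Q) (slowStates Q)

/-- The transition rate matrix `Γ = Q_BB + Q_BA (I - Ω_AA)⁻¹ Ω_AB` of the reduced chain. -/
noncomputable def reducedRate (Q : ℝ → Matrix S S ℝ) : Matrix (slowStates Q) (slowStates Q) ℝ :=
  block (limRate Q) (slowStates Q) (slowStates Q) +
    block (limRate Q) (slowStates Q) (fastStates Q) * exitMatrix Q

/-- The distribution `γ(π) = π_B + π_A (I - Ω_AA)⁻¹ Ω_AB` on the slow states. -/
noncomputable def reducedInit (Q : ℝ → Matrix S S ℝ) (p : S → ℝ) : slowStates Q → ℝ :=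
  (fun j : slowStates Q => p j) + Matrix.vecMul (fun i : fastStates Q => p i) (exitMatrix Q)

end Reduction

end TwoTimeScale

/-! The semigroup of `Q(λ)` is compared with an ansatz by a maximum principle. For a function `f` on
`S`, let `y` solve `y' = Γ y` on `B` with `y(0) = f|_B`, and extend `y(t)` to `A` by averaging over
the exit distribution of the jump chain of `Q(λ)`. The extension `u` is annihilated by `Q(λ)` on
`A`, so `u' - Q(λ) u` tends to 0 on `B` but is only bounded on `A`.

The error on `A` is harmless: the mean exit time `V` from `A` satisfies `Q(λ) V = -1` on `A`, while
`V` itself and `Q(λ) V` on `B` tend to 0, so a multiple of `V` absorbs it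
(`IsRateMatrix.abs_sub_exp_mulVec_le`). The values at time 0 differ only on `A`, and this is
forgotten by time `h`, since the chain is then unlikely to be in `A`
(`IsRateMatrix.exp_mulVec_indicator_le`). `abs_exp_sub_extendByOne_le` collects the errors and
`IsTwoTimeScale.eventually_abs_exp_sub_le` lets `λ → ∞`. Everything rests on the invertibility of `I
- Ω_AA` (`det_one_sub_block_ne_zero`), which comes from almost sure exit from `A`. -/

namespace TwoTimeScale

/-! ### Positivity, mass conservation and comparison for `exp (t Q)`. -/

section Semigroup

variable {E : Type*} [Fintype E] [DecidableEq E]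

open scoped Matrix.Norms.Operator in
theorem hasDerivAt_exp_smul_apply (M : Matrix E E ℝ) (t : ℝ) (i j : E) :
    HasDerivAt (fun s : ℝ => NormedSpace.exp (s • M) i j)
      ((NormedSpace.exp (t • M) * M) i j) t := by
  have h := hasDerivAt_exp_smul_const (𝕂 := ℝ) M t
  exact hasDerivAt_pi.1 (hasDerivAt_pi.1 h i) j

open scoped Matrix.Norms.Operator in
theorem hasDerivAt_exp_smul_apply' (M : Matrix E E ℝ) (t : ℝ) (i j : E) :
    HasDerivAt (fun s : ℝ => NormedSpace.exp (s • M) i j)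
      ((M * NormedSpace.exp (t • M)) i j) t := by
  have h := hasDerivAt_exp_smul_const' (𝕂 := ℝ) M t
  exact hasDerivAt_pi.1 (hasDerivAt_pi.1 h i) j

open scoped Matrix.Norms.Operator in
theorem exp_apply_nonneg_of_nonneg {M : Matrix E E ℝ} (hM : ∀ i j, 0 ≤ M i j) (i j : E) :
    0 ≤ NormedSpace.exp M i j := by
  have h := NormedSpace.exp_series_hasSum_exp' (𝕂 := ℝ) M
  have h2 : HasSum (fun n : ℕ => ((n.factorial : ℝ)⁻¹ • M ^ n) i j) (NormedSpace.exp M i j) :=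
    Pi.hasSum.1 (Pi.hasSum.1 h i) j
  have hp : ∀ (n : ℕ) i j, 0 ≤ (M ^ n) i j := by
    intro n
    induction n with
    | zero => intro i j; rw [pow_zero, Matrix.one_apply]; split_ifs <;> norm_num
    | succ n ih =>
      intro i j
      rw [pow_succ, Matrix.mul_apply]
      exact Finset.sum_nonneg fun k _ => mul_nonneg (ih i k) (hM k j)
  refine h2.nonneg fun n => ?_
  rw [Matrix.smul_apply, smul_eq_mul]
  exact mul_nonneg (by positivity) (hp n i j)

/-- Adding a large multiple `c` of the identity makes all entries of `t Q` nonnegative; it commutes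
with everything and costs only the positive factor `exp (-c)`. -/
theorem IsRateMatrix.exp_apply_nonneg {Q : Matrix E E ℝ} (hQ : IsRateMatrix Q) {t : ℝ}
    (ht : 0 ≤ t) (i j : E) : 0 ≤ NormedSpace.exp (t • Q) i j := by
  set c : ℝ := ∑ k, t * |Q k k|
  have hc : ∀ k, t * |Q k k| ≤ c := fun k =>
    Finset.single_le_sum (f := fun k => t * |Q k k|) (fun k _ => by positivity)
      (Finset.mem_univ k)
  have hnn : ∀ i j, 0 ≤ (t • Q + c • (1 : Matrix E E ℝ)) i j := by
    intro i j
    simp only [Matrix.add_apply, Matrix.smul_apply, smul_eq_mul]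
    by_cases hij : i = j
    · subst hij
      have := mul_le_mul_of_nonneg_left (neg_abs_le (Q i i)) ht
      have := hc i
      simp only [Matrix.one_apply_eq]
      linarith
    · simpa [Matrix.one_apply_ne hij] using mul_nonneg ht (hQ.nonneg i j hij)
  have hsplit : t • Q = (t • Q + c • (1 : Matrix E E ℝ)) + (Matrix.diagonal fun _ => -c) := by
    rw [← Matrix.smul_one_eq_diagonal, neg_smul]; abel
  have hcomm : Commute (t • Q + c • (1 : Matrix E E ℝ)) (Matrix.diagonal fun _ => -c) := by
    rw [← Matrix.smul_one_eq_diagonal]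
    exact (Commute.one_right _).smul_right _
  rw [hsplit, Matrix.exp_add_of_commute _ _ hcomm, Matrix.exp_diagonal, Matrix.mul_diagonal]
  refine mul_nonneg (exp_apply_nonneg_of_nonneg hnn i j) ?_
  rw [Pi.coe_exp, ← Real.exp_eq_exp_ℝ]
  exact (Real.exp_pos _).le

open Matrix in
/-- A subsolution of `u' = Q u` stays below the solution with the same initial value. -/
theorem IsRateMatrix.le_exp_mulVec {Q : Matrix E E ℝ} (hQ : IsRateMatrix Q) {t : ℝ}
    (ht : 0 ≤ t) {u u' : ℝ → E → ℝ} (hu : ∀ s i, HasDerivAt (fun r => u r i) (u' s i) s)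
    (hle : ∀ s, 0 ≤ s → s ≤ t → ∀ i, u' s i ≤ (Q *ᵥ u s) i) (i : E) :
    u t i ≤ (NormedSpace.exp (t • Q) *ᵥ u 0) i := by
  -- Duhamel interpolation between `exp (t Q) u(0)` and `u t`: its derivative is `exp ((t - s) Q)`
  -- applied to the nonpositive defect `u' - Q u`.
  set w : ℝ → ℝ := fun s => (NormedSpace.exp ((t - s) • Q) *ᵥ u s) i with hw
  have hd : ∀ s, HasDerivAt w
      ((NormedSpace.exp ((t - s) • Q) *ᵥ (u' s - Q *ᵥ u s)) i) s := by
    intro s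
    have h1 : HasDerivAt w (∑ j, (-(NormedSpace.exp ((t - s) • Q) * Q) i j * u s j +
        NormedSpace.exp ((t - s) • Q) i j * u' s j)) s := by
      refine HasDerivAt.fun_sum fun j _ => HasDerivAt.mul ?_ (hu s j)
      have h2 := (hasDerivAt_exp_smul_apply Q (t - s) i j).comp s
        ((hasDerivAt_id s).const_sub t)
      rw [mul_neg_one] at h2
      exact h2
    convert h1 using 1
    rw [mulVec_sub, mulVec_mulVec, Finset.sum_add_distrib, Pi.sub_apply, sub_eq_neg_add]
    simp [mulVec, dotProduct]
  have hanti : AntitoneOn w (Set.Icc 0 t) := by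
    refine antitoneOn_of_deriv_nonpos (convex_Icc 0 t)
      (fun s _ => (hd s).continuousAt.continuousWithinAt)
      (fun s _ => (hd s).differentiableAt.differentiableWithinAt) fun s hs => ?_
    rw [interior_Icc] at hs
    rw [(hd s).deriv]
    refine Finset.sum_nonpos fun j _ => mul_nonpos_of_nonneg_of_nonpos
      (hQ.exp_apply_nonneg (by linarith [hs.2]) i j) ?_
    simpa using hle s hs.1.le hs.2.le j
  have := hanti (Set.left_mem_Icc.2 ht) (Set.right_mem_Icc.2 ht) ht
  simpa [hw, NormedSpace.exp_zero] using this

open Matrix in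
theorem IsRateMatrix.mulVec_const {E : Type*} [Fintype E] {Q : Matrix E E ℝ}
    (hQ : IsRateMatrix Q) (c : ℝ) :
    Q *ᵥ (fun _ => c) = 0 := by
  ext i
  simp [mulVec, dotProduct, ← Finset.sum_mul, hQ.row_sum]

theorem IsRateMatrix.exp_row_sum {Q : Matrix E E ℝ} (hQ : IsRateMatrix Q) {t : ℝ}
    (ht : 0 ≤ t) (i : E) : ∑ j, NormedSpace.exp (t • Q) i j = 1 := by
  -- Constants are stationary solutions; `c = 1` and `c = -1` give the two inequalities.
  have key : ∀ c : ℝ, c ≤ (∑ j, NormedSpace.exp (t • Q) i j) * c := by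
    intro c
    have := hQ.le_exp_mulVec ht (u := fun _ _ => c) (u' := fun _ _ => 0)
      (fun s i => hasDerivAt_const _ _) (fun s _ _ i => by rw [hQ.mulVec_const]; rfl) i
    simpa [Matrix.mulVec, dotProduct, ← Finset.sum_mul] using this
  have h1 := key 1
  have h2 := key (-1)
  linarith

open Matrix in
theorem IsRateMatrix.exp_mulVec_mono {Q : Matrix E E ℝ} (hQ : IsRateMatrix Q) {t : ℝ}
    (ht : 0 ≤ t) {f g : E → ℝ} (hfg : ∀ i, f i ≤ g i) (i : E) :
    (NormedSpace.exp (t • Q) *ᵥ f) i ≤ (NormedSpace.exp (t • Q) *ᵥ g) i :=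
  Finset.sum_le_sum fun j _ => mul_le_mul_of_nonneg_left (hfg j) (hQ.exp_apply_nonneg ht i j)

open Matrix in
theorem IsRateMatrix.exp_mulVec_const {Q : Matrix E E ℝ} (hQ : IsRateMatrix Q) {t : ℝ}
    (ht : 0 ≤ t) (c : ℝ) (i : E) : (NormedSpace.exp (t • Q) *ᵥ fun _ => c) i = c := by
  simp [mulVec, dotProduct, ← Finset.sum_mul, hQ.exp_row_sum ht]

end Semigroup

/-! ### Comparison estimates with a corrector on the fast set. -/

section Bounds

variable {E : Type*} [Fintype E] [DecidableEq E]

open Matrix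

/-- Subtracting `K V + (K d + r) s` from `u` gives a subsolution: `-K Q V` equals `K` on `A`, which
pays for the error there, and is at least `-K d` off `A`, which the linear term pays for together
with `r`. Bounding `K V` at both ends of the time interval costs `2 K e`. -/
theorem IsRateMatrix.le_exp_mulVec_add {Q : Matrix E E ℝ} (hQ : IsRateMatrix Q) {t : ℝ}
    (ht : 0 ≤ t) {A : Finset E} {V : E → ℝ} {e d : ℝ} (hV : ∀ i, |V i| ≤ e)
    (hVA : ∀ i ∈ A, (Q *ᵥ V) i = -1) (hVB : ∀ i ∉ A, |(Q *ᵥ V) i| ≤ d) (hd : 0 ≤ d)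
    {K r : ℝ} (hK : 0 ≤ K) (hr : 0 ≤ r) {u u' : ℝ → E → ℝ}
    (hu : ∀ s i, HasDerivAt (fun x => u x i) (u' s i) s)
    (hA : ∀ s, 0 ≤ s → s ≤ t → ∀ i ∈ A, u' s i - (Q *ᵥ u s) i ≤ K)
    (hB : ∀ s, 0 ≤ s → s ≤ t → ∀ i ∉ A, u' s i - (Q *ᵥ u s) i ≤ r) (i : E) :
    u t i ≤ (NormedSpace.exp (t • Q) *ᵥ u 0) i + (2 * K * e + (K * d + r) * t) := by
  have hexp : ∀ s, u s - K • V - (fun _ => (K * d + r) * s) =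
      fun i => u s i - K * V i - (K * d + r) * s := fun s => rfl
  have hsub := hQ.le_exp_mulVec ht
    (u := fun s i => u s i - K * V i - (K * d + r) * s) (u' := fun s i => u' s i - (K * d + r))
    (fun s i => by
      have h1 := ((hu s i).sub_const (K * V i)).sub ((hasDerivAt_id s).const_mul (K * d + r))
      rw [mul_one] at h1
      exact h1)
    (fun s hs hst i => by
      rw [← hexp, mulVec_sub, mulVec_sub, mulVec_smul, hQ.mulVec_const]
      simp only [Pi.sub_apply, Pi.smul_apply, Pi.zero_apply, smul_eq_mul]
      by_cases hi : i ∈ A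
      · have := hA s hs hst i hi
        rw [hVA i hi]
        nlinarith [mul_nonneg hK hd]
      · have := hB s hs hst i hi
        nlinarith [mul_le_mul_of_nonneg_left ((le_abs_self _).trans (hVB i hi)) hK]) i
  have hmono := hQ.exp_mulVec_mono ht (f := fun i => u 0 i - K * V i - (K * d + r) * 0)
    (g := u 0 + fun _ => K * e) (fun i => by
      have := mul_le_mul_of_nonneg_left (neg_le_of_abs_le (hV i)) hK
      simp only [Pi.add_apply]
      linarith) i
  rw [mulVec_add, Pi.add_apply, hQ.exp_mulVec_const ht] at hmono
  have := mul_le_mul_of_nonneg_left ((le_abs_self _).trans (hV i)) hK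
  linarith

/-- If `u` solves `u' = Q u` up to an error that is at most `K` on `A` and at most `r` off `A`,
and `V` is a small function with `Q V = -1` on `A`, then `u` is close to `exp (t Q) u(0)`. -/
theorem IsRateMatrix.abs_sub_exp_mulVec_le {Q : Matrix E E ℝ} (hQ : IsRateMatrix Q) {t : ℝ}
    (ht : 0 ≤ t) {A : Finset E} {V : E → ℝ} {e d : ℝ} (hV : ∀ i, |V i| ≤ e)
    (hVA : ∀ i ∈ A, (Q *ᵥ V) i = -1) (hVB : ∀ i ∉ A, |(Q *ᵥ V) i| ≤ d) (hd : 0 ≤ d)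
    {K r : ℝ} (hK : 0 ≤ K) (hr : 0 ≤ r) {u u' : ℝ → E → ℝ}
    (hu : ∀ s i, HasDerivAt (fun x => u x i) (u' s i) s)
    (hA : ∀ s, 0 ≤ s → s ≤ t → ∀ i ∈ A, |u' s i - (Q *ᵥ u s) i| ≤ K)
    (hB : ∀ s, 0 ≤ s → s ≤ t → ∀ i ∉ A, |u' s i - (Q *ᵥ u s) i| ≤ r) (i : E) :
    |u t i - (NormedSpace.exp (t • Q) *ᵥ u 0) i| ≤ 2 * K * e + (K * d + r) * t := by
  have h1 := hQ.le_exp_mulVec_add ht hV hVA hVB hd hK hr hu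
    (fun s hs hst i hi => (le_abs_self _).trans (hA s hs hst i hi))
    (fun s hs hst i hi => (le_abs_self _).trans (hB s hs hst i hi)) i
  have h2 := hQ.le_exp_mulVec_add ht hV hVA hVB hd hK hr (u := fun s => -u s)
    (u' := fun s => -u' s) (fun s i => (hu s i).neg)
    (fun s hs hst i hi => by
      have := (neg_le_abs _).trans (hA s hs hst i hi)
      rw [mulVec_neg, Pi.neg_apply, Pi.neg_apply]
      linarith)
    (fun s hs hst i hi => by
      have := (neg_le_abs _).trans (hB s hs hst i hi)
      rw [mulVec_neg, Pi.neg_apply, Pi.neg_apply]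
      linarith) i
  rw [mulVec_neg, Pi.neg_apply, Pi.neg_apply] at h2
  rw [abs_le]
  constructor <;> linarith

/-- Bound on the probability of being in `A` at any time after `s`. -/
theorem IsRateMatrix.exp_mulVec_indicator_le {Q : Matrix E E ℝ} (hQ : IsRateMatrix Q) {s t : ℝ}
    (hs : 0 < s) (hst : s ≤ t) {A : Finset E} {V : E → ℝ} {e d C : ℝ} (hV : ∀ i, |V i| ≤ e)
    (hVA : ∀ i ∈ A, (Q *ᵥ V) i = -1) (hVB : ∀ i ∉ A, |(Q *ᵥ V) i| ≤ d) (hd : 0 ≤ d)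
    (hC : 0 ≤ C) (hQA : ∀ i, (Q *ᵥ fun j => if j ∈ A then (1 : ℝ) else 0) i ≤ C) (i : E) :
    (NormedSpace.exp (t • Q) *ᵥ fun j => if j ∈ A then (1 : ℝ) else 0) i ≤
      2 * e / s + d + s * C := by
  set f : E → ℝ := fun j => if j ∈ A then (1 : ℝ) else 0 with hf
  have hexp : ∀ r, -V - (s - r) • f - (fun _ => (d + s * C) * r) =
      fun i => -V i - (s - r) * f i - (d + s * C) * r := fun r => rfl
  have hsmall : ∀ i, (NormedSpace.exp (s • Q) *ᵥ f) i ≤ 2 * e / s + d + s * C := by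
    intro i
    -- The term `-V` controls the time spent in `A` up to `s`. The weight `s - r` turns this
    -- integral bound into one at time `s`, since the probability of being in `A` grows at rate at
    -- most `C`; it vanishes at `r = s` and leaves `s f` at `r = 0`.
    have hsub := hQ.le_exp_mulVec hs.le
      (u := fun r i => -V i - (s - r) * f i - (d + s * C) * r)
      (u' := fun r i => f i - (d + s * C))
      (fun r i => by
        have h1 := ((((hasDerivAt_id r).const_sub s).mul_const (f i)).const_sub (-V i)).sub
          ((hasDerivAt_id r).const_mul (d + s * C))
        exact h1.congr_deriv (by simp))
      (fun r hr hrs i => by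
        rw [← hexp, mulVec_sub, mulVec_sub, mulVec_smul, hQ.mulVec_const, mulVec_neg]
        simp only [Pi.sub_apply, Pi.smul_apply, Pi.zero_apply, Pi.neg_apply, smul_eq_mul]
        have h1 : (s - r) * (Q *ᵥ f) i ≤ s * C :=
          (mul_le_mul_of_nonneg_left (hQA i) (by linarith)).trans
            (mul_le_mul_of_nonneg_right (by linarith) hC)
        by_cases hi : i ∈ A
        · rw [hVA i hi]
          simp only [hf, hi, if_true]
          linarith
        · have := (le_abs_self _).trans (hVB i hi)
          simp only [hf, hi, if_false] at h1 ⊢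
          linarith) i
    have hmono := hQ.exp_mulVec_mono hs.le (f := fun i => -V i - (s - 0) * f i - (d + s * C) * 0)
      (g := (fun _ => e) - s • f) (fun i => by
        have := neg_le_of_abs_le (hV i)
        simp only [Pi.sub_apply, Pi.smul_apply, smul_eq_mul]
        linarith) i
    rw [mulVec_sub, mulVec_smul, Pi.sub_apply, hQ.exp_mulVec_const hs.le, Pi.smul_apply,
      smul_eq_mul] at hmono
    have h3 := (le_abs_self _).trans (hV i)
    have h4 : (NormedSpace.exp (s • Q) *ᵥ f) i * s ≤ 2 * e + (d + s * C) * s := by linarith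
    have h5 := (le_div_iff₀ hs).2 h4
    have h6 : (2 * e + (d + s * C) * s) / s = 2 * e / s + d + s * C := by
      field_simp
      ring
    linarith
  -- The bound at time `s` is uniform in the starting state, so conditioning at time `t - s` extends
  -- it to `t`.
  have hsplit : t • Q = (t - s) • Q + s • Q := by rw [← add_smul, sub_add_cancel]
  rw [hsplit, Matrix.exp_add_of_commute _ _ (((Commute.refl Q).smul_right s).smul_left (t - s)),
    ← mulVec_mulVec]
  have := hQ.exp_mulVec_mono (sub_nonneg.2 hst) hsmall i
  rwa [hQ.exp_mulVec_const (sub_nonneg.2 hst)] at this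

end Bounds

/-! ### First-step analysis on `A` and the error bound for fixed `λ`. -/

section Blocks

variable {S : Type*} [Fintype S] [DecidableEq S] {A B : Finset S}

open Matrix

/-- Probabilities of leaving `A` through the states of `B`, for the jump matrix `W`. -/
noncomputable def exitProb (W : Matrix S S ℝ) (A B : Finset S) : Matrix A B ℝ :=
  (1 - block W A A)⁻¹ * block W A B

/-- Rate matrix on `B` obtained by redirecting the transitions into `A` according to `N`. -/
def effectiveRate (R : Matrix S S ℝ) (N : Matrix A B ℝ) : Matrix B B ℝ :=
  block R B B + block R B A * N

/-- Extension of the matrix `N` by the identity on `B`. -/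
def extendByOne (N : Matrix A B ℝ) : Matrix S B ℝ :=
  Matrix.of fun i b => if hi : i ∈ A then N ⟨i, hi⟩ b else if i = b then 1 else 0

/-- Mean time spent in `A` before leaving it. -/
noncomputable def meanExitTime (Q : Matrix S S ℝ) (A : Finset S) : S → ℝ := fun i =>
  if hi : i ∈ A then
    ((1 - block (jumpMatrix Q) A A)⁻¹ *ᵥ fun a : A => (-Q a a)⁻¹) ⟨i, hi⟩
  else 0

theorem sum_eq_sum_add_sum {S : Type*} [Fintype S] {A B : Finset S}
    (hAB : ∀ i, i ∈ B ↔ i ∉ A) (f : S → ℝ) :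
    ∑ i, f i = ∑ a : A, f a + ∑ b : B, f b := by
  classical
  have hB : B = Aᶜ := by ext i; rw [hAB, Finset.mem_compl]
  rw [Finset.sum_coe_sort A f, Finset.sum_coe_sort B f, hB, Finset.sum_add_sum_compl]

/-- Factors the diverging exit rate out of a row, so that equations on `A` involve only the jump
matrix, which has a limit. -/
theorem mulVec_eq_exitRate_mul {Q : Matrix S S ℝ} (v : S → ℝ) {i : S} (hi : Q i i ≠ 0) :
    (Q *ᵥ v) i = -Q i i * ((jumpMatrix Q *ᵥ v) i - v i) := by
  have h : ∀ k, Q i k * v k =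
      -Q i i * (jumpMatrix Q i k * v k) + (if i = k then Q i i * v i else 0) := by
    intro k
    rw [jumpMatrix, of_apply]
    split_ifs with hik
    · subst hik; ring
    · field_simp; ring
  simp only [mulVec, dotProduct]
  rw [Finset.sum_congr rfl fun k _ => h k, Finset.sum_add_distrib, ← Finset.mul_sum,
    Finset.sum_ite_eq]
  simp only [Finset.mem_univ, if_true]
  ring

theorem extendByOne_mulVec_fast {S : Type*} [DecidableEq S] {A B : Finset S}
    (N : Matrix A B ℝ) (g : B → ℝ) (a : A) :
    (extendByOne N *ᵥ g) a = (N *ᵥ g) a := by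
  simp [extendByOne, mulVec, dotProduct]

theorem extendByOne_mulVec_slow {S : Type*} [DecidableEq S] {A B : Finset S}
    (hAB : ∀ i, i ∈ B ↔ i ∉ A) (N : Matrix A B ℝ) (g : B → ℝ)
    (b : B) : (extendByOne N *ᵥ g) b = g b := by
  simp [extendByOne, mulVec, dotProduct, (hAB b).1 b.2]

theorem mulVec_eq_block_add_block {S : Type*} [Fintype S] {A B : Finset S}
    (hAB : ∀ i, i ∈ B ↔ i ∉ A) (M : Matrix S S ℝ) (v : S → ℝ)
    {C : Finset S} (c : C) :
    (M *ᵥ v) c = (block M C A *ᵥ fun a => v a) c + (block M C B *ᵥ fun b => v b) c :=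
  sum_eq_sum_add_sum hAB fun k => M c k * v k

theorem mulVec_extendByOne_slow (hAB : ∀ i, i ∈ B ↔ i ∉ A) (M : Matrix S S ℝ) (N : Matrix A B ℝ)
    (g : B → ℝ) (b : B) :
    (M *ᵥ (extendByOne N *ᵥ g)) b = (effectiveRate M N *ᵥ g) b := by
  rw [mulVec_eq_block_add_block hAB M _ b, effectiveRate, add_mulVec, ← mulVec_mulVec,
    Pi.add_apply, add_comm]
  simp only [extendByOne_mulVec_fast, extendByOne_mulVec_slow hAB]

/-- The first-step equation `(I - W_AA) N = W_AB` for the exit probabilities says exactly that the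
extension is harmonic on `A`. -/
theorem mulVec_extendByOne_fast (hAB : ∀ i, i ∈ B ↔ i ∉ A) {Q : Matrix S S ℝ}
    (hq : ∀ i ∈ A, Q i i ≠ 0) (hdet : IsUnit (1 - block (jumpMatrix Q) A A).det) (g : B → ℝ)
    (a : A) : (Q *ᵥ (extendByOne (exitProb (jumpMatrix Q) A B) *ᵥ g)) a = 0 := by
  rw [mulVec_eq_exitRate_mul _ (hq a a.2), mulVec_eq_block_add_block hAB _ _ a]
  simp only [extendByOne_mulVec_fast, extendByOne_mulVec_slow hAB]
  have h : (1 - block (jumpMatrix Q) A A) * exitProb (jumpMatrix Q) A B =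
      block (jumpMatrix Q) A B := by
    rw [exitProb, ← Matrix.mul_assoc, mul_nonsing_inv _ hdet, Matrix.one_mul]
  have h2 := congrFun (congrArg (fun M => M *ᵥ g) h) a
  simp only [← mulVec_mulVec, sub_mulVec, one_mulVec, Pi.sub_apply] at h2
  have h3 : (fun a : A => (exitProb (jumpMatrix Q) A B *ᵥ g) a) =
    exitProb (jumpMatrix Q) A B *ᵥ g := rfl
  have h4 : (fun b : B => g b) = g := rfl
  rw [h3, h4, ← h2]
  ring

theorem mulVec_meanExitTime_slow (hAB : ∀ i, i ∈ B ↔ i ∉ A) (Q : Matrix S S ℝ) (b : B) :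
    (Q *ᵥ meanExitTime Q A) b = (block Q B A *ᵥ fun a => meanExitTime Q A a) b := by
  rw [mulVec_eq_block_add_block hAB _ _ b]
  have : (fun b : B => meanExitTime Q A b) = 0 := by
    ext b
    simp [meanExitTime, (hAB b).1 b.2]
  rw [this, mulVec_zero, Pi.zero_apply, add_zero]

theorem mulVec_meanExitTime_fast (hAB : ∀ i, i ∈ B ↔ i ∉ A) {Q : Matrix S S ℝ}
    (hq : ∀ i ∈ A, Q i i ≠ 0) (hdet : IsUnit (1 - block (jumpMatrix Q) A A).det)
    (a : A) : (Q *ᵥ meanExitTime Q A) a = -1 := by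
  rw [mulVec_eq_exitRate_mul _ (hq a a.2), mulVec_eq_block_add_block hAB _ _ a]
  have h0 : (fun b : B => meanExitTime Q A b) = 0 := by
    ext b
    simp [meanExitTime, (hAB b).1 b.2]
  have h1 : (fun a : A => meanExitTime Q A a) =
      (1 - block (jumpMatrix Q) A A)⁻¹ *ᵥ fun a : A => (-Q a a)⁻¹ := by
    ext a
    simp [meanExitTime]
  have h2 : (1 - block (jumpMatrix Q) A A) *ᵥ (fun a : A => meanExitTime Q A a) =
      fun a : A => (-Q a a)⁻¹ := by
    rw [h1, mulVec_mulVec, mul_nonsing_inv _ hdet, one_mulVec]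
  have h3 := congrFun h2 a
  simp only [sub_mulVec, one_mulVec, Pi.sub_apply] at h3
  rw [h0, mulVec_zero, Pi.zero_apply, add_zero, ← neg_sub (meanExitTime Q A a), h3]
  have := hq a a.2
  field_simp

/-- From inside `A` the indicator can only decrease; from outside, the rate into `A` is at most the
exit rate. Hence only slow rates appear, and the bound survives the limit. -/
theorem IsRateMatrix.mulVec_indicator_le {Q : Matrix S S ℝ} (hQ : IsRateMatrix Q)
    (hAB : ∀ i, i ∈ B ↔ i ∉ A) (i : S) :
    (Q *ᵥ fun j => if j ∈ A then (1 : ℝ) else 0) i ≤ ∑ b : B, |Q b b| := by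
  have h0 : (0 : ℝ) ≤ ∑ b : B, |Q b b| := Finset.sum_nonneg fun _ _ => abs_nonneg _
  by_cases hi : i ∈ A
  · refine le_trans ?_ ((hQ.row_sum i).le.trans h0)
    refine Finset.sum_le_sum fun j _ => ?_
    dsimp only
    split_ifs with hj
    · rw [mul_one]
    · rw [mul_zero]
      exact hQ.nonneg i j fun h => hj (h ▸ hi)
  · have h1 : |Q i i| ≤ ∑ b : B, |Q b b| :=
      Finset.single_le_sum (f := fun b : B => |Q b b|) (fun _ _ => abs_nonneg _)
        (Finset.mem_univ (⟨i, (hAB i).2 hi⟩ : B))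
    have h2 : (Q *ᵥ fun j => if j ∈ A then (1 : ℝ) else 0) i ≤
        ∑ j, (Q i j + if i = j then |Q i i| else 0) := by
      refine Finset.sum_le_sum fun j _ => ?_
      dsimp only
      by_cases hij : i = j
      · subst hij
        simp only [hi, if_false, mul_zero, if_true]
        linarith [neg_abs_le (Q i i)]
      · have := hQ.nonneg i j hij
        rw [if_neg hij, add_zero]
        split_ifs <;> linarith
    rw [Finset.sum_add_distrib, hQ.row_sum, Finset.sum_ite_eq, zero_add] at h2
    simp only [Finset.mem_univ, if_true] at h2
    exact h2.trans h1

/-- The three summands are the initial mismatch on `A`, the defect of the ansatz in the equation for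
`Q`, and the replacement of `N'` by its eventual limit `N`. -/
theorem abs_exp_sub_extendByOne_le {Q : Matrix S S ℝ} (hQ : IsRateMatrix Q)
    (hAB : ∀ i, i ∈ B ↔ i ∉ A) (hq : ∀ i ∈ A, Q i i ≠ 0)
    (hdet : IsUnit (1 - block (jumpMatrix Q) A A).det) {N' : Matrix A B ℝ}
    (hN' : N' = exitProb (jumpMatrix Q) A B) (N : Matrix A B ℝ) (G : Matrix B B ℝ)
    {s t : ℝ} (hs : 0 < s) (hst : s ≤ t) {e d r K K₁ ρ : ℝ}
    (hV : ∀ i, |meanExitTime Q A i| ≤ e)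
    (hd : ∀ b : B, |(block Q B A *ᵥ fun a => meanExitTime Q A a) b| ≤ d)
    (hd0 : 0 ≤ d) (hK0 : 0 ≤ K) (hr0 : 0 ≤ r) (hK₁0 : 0 ≤ K₁)
    (f : S → ℝ)
    (hK : ∀ x, 0 ≤ x → x ≤ t → ∀ i,
      |(extendByOne N' *ᵥ (G *ᵥ (NormedSpace.exp (x • G) *ᵥ fun b => f b))) i| ≤ K)
    (hr : ∀ x, 0 ≤ x → x ≤ t → ∀ b,
      |((G - effectiveRate Q N') *ᵥ (NormedSpace.exp (x • G) *ᵥ fun b => f b)) b| ≤ r)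
    (hK₁ : ∀ i, |f i - (extendByOne N' *ᵥ fun b => f b) i| ≤ K₁)
    (hρ : ∀ i, |((extendByOne N' - extendByOne N) *ᵥ
      (NormedSpace.exp (t • G) *ᵥ fun b => f b)) i| ≤ ρ) (i : S) :
    |(NormedSpace.exp (t • Q) *ᵥ f) i -
        (extendByOne N *ᵥ (NormedSpace.exp (t • G) *ᵥ fun b => f b)) i| ≤
      K₁ * (2 * e / s + d + s * ∑ b : B, |Q b b|) + (2 * K * e + (K * d + r) * t) + ρ := by
  have ht : 0 ≤ t := hs.le.trans hst
  set g : B → ℝ := fun b => f b with hg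
  set y : ℝ → B → ℝ := fun x => NormedSpace.exp (x • G) *ᵥ g with hy
  have hVA : ∀ i ∈ A, (Q *ᵥ meanExitTime Q A) i = -1 := fun i hi =>
    mulVec_meanExitTime_fast hAB hq hdet ⟨i, hi⟩
  have hVB : ∀ i ∉ A, |(Q *ᵥ meanExitTime Q A) i| ≤ d := fun i hi => by
    have h1 := mulVec_meanExitTime_slow hAB Q ⟨i, (hAB i).2 hi⟩
    have h2 := hd ⟨i, (hAB i).2 hi⟩
    rwa [← h1] at h2
  have hyd : ∀ x b, HasDerivAt (fun x => y x b) ((G *ᵥ y x) b) x := by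
    intro x b
    have h1 : HasDerivAt (fun x => y x b)
        (∑ c, (G * NormedSpace.exp (x • G)) b c * g c) x :=
      HasDerivAt.fun_sum fun c _ => (hasDerivAt_exp_smul_apply' G x b c).mul_const (g c)
    rw [hy, mulVec_mulVec]
    exact h1
  have hu : ∀ x i, HasDerivAt (fun x => (extendByOne N' *ᵥ y x) i)
      ((extendByOne N' *ᵥ (G *ᵥ y x)) i) x := fun x i =>
    HasDerivAt.fun_sum fun b _ => (hyd x b).const_mul _
  have h2 := hQ.abs_sub_exp_mulVec_le ht hV hVA hVB hd0 hK0 hr0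
    (u := fun x => extendByOne N' *ᵥ y x) (u' := fun x => extendByOne N' *ᵥ (G *ᵥ y x)) hu
    (fun x hx hxt i hi => by
      have h := mulVec_extendByOne_fast hAB hq hdet (y x) ⟨i, hi⟩
      rw [← hN'] at h
      change (Q *ᵥ (extendByOne N' *ᵥ y x)) i = 0 at h
      rw [h, sub_zero]
      exact hK x hx hxt i)
    (fun x hx hxt i hi => by
      have h := mulVec_extendByOne_slow hAB Q N' (y x) ⟨i, (hAB i).2 hi⟩
      have h' := extendByOne_mulVec_slow hAB N' (G *ᵥ y x) ⟨i, (hAB i).2 hi⟩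
      have h'' := hr x hx hxt ⟨i, (hAB i).2 hi⟩
      dsimp only at h h' h'' ⊢
      rw [h, h']
      rwa [sub_mulVec] at h'') i
  have hy0 : y 0 = g := by simp [hy]
  simp only [hy0] at h2
  -- The extension agrees with `f` on `B`, so the mismatch is dominated by a multiple of the
  -- indicator of `A`.
  have hdiff : ∀ i, |(f - extendByOne N' *ᵥ g) i| ≤
      (K₁ • fun j => if j ∈ A then (1 : ℝ) else 0) i := by
    intro i
    simp only [Pi.sub_apply, Pi.smul_apply, smul_eq_mul]
    split_ifs with hi
    · rw [mul_one]; exact hK₁ i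
    · have h := extendByOne_mulVec_slow hAB N' g ⟨i, (hAB i).2 hi⟩
      dsimp only at h
      rw [h, sub_self, abs_zero, mul_zero]
  have h1 := hQ.exp_mulVec_indicator_le hs hst hV hVA hVB hd0
    (Finset.sum_nonneg fun _ _ => abs_nonneg _) (hQ.mulVec_indicator_le hAB) i
  have h1' := mul_le_mul_of_nonneg_left h1 hK₁0
  have h3 := hQ.exp_mulVec_mono ht (fun i => (le_abs_self _).trans (hdiff i)) i
  have h4 := hQ.exp_mulVec_mono ht (f := -(f - extendByOne N' *ᵥ g))
    (fun i => (neg_le_abs _).trans (hdiff i)) i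
  rw [mulVec_smul, Pi.smul_apply, smul_eq_mul] at h3 h4
  rw [mulVec_neg, Pi.neg_apply] at h4
  rw [mulVec_sub, Pi.sub_apply] at h3 h4
  have h5 := hρ i
  rw [sub_mulVec, Pi.sub_apply] at h5
  rw [abs_le] at h2 h5 ⊢
  change _ ≤ (extendByOne N' *ᵥ y t) i - (extendByOne N *ᵥ y t) i ∧
    (extendByOne N' *ᵥ y t) i - (extendByOne N *ᵥ y t) i ≤ _ at h5
  change _ ≤ _ - (extendByOne N *ᵥ y t) i ∧ _ - (extendByOne N *ᵥ y t) i ≤ _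
  constructor <;> linarith [h2.1, h2.2, h5.1, h5.2]

end Blocks

/-! ### Passage to the limit `λ → ∞`. -/

section Limits

variable {S : Type*} [Fintype S] [DecidableEq S]

open Matrix

theorem IsRateMatrix.exitRate_eq_sum {Q : Matrix S S ℝ} (hQ : IsRateMatrix Q) (i : S) :
    -Q i i = ∑ j ∈ Finset.univ.erase i, Q i j := by
  have h := hQ.row_sum i
  rw [← Finset.add_sum_erase _ _ (Finset.mem_univ i)] at h
  linarith

theorem IsRateMatrix.le_exitRate {Q : Matrix S S ℝ} (hQ : IsRateMatrix Q) {i j : S}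
    (hij : i ≠ j) : Q i j ≤ -Q i i := by
  rw [hQ.exitRate_eq_sum i]
  exact Finset.single_le_sum (fun k hk => hQ.nonneg i k (Finset.ne_of_mem_erase hk).symm)
    (Finset.mem_erase.2 ⟨hij.symm, Finset.mem_univ j⟩)

theorem IsRateMatrix.exitRate_nonneg {Q : Matrix S S ℝ} (hQ : IsRateMatrix Q) (i : S) :
    0 ≤ -Q i i := by
  rw [hQ.exitRate_eq_sum i]
  exact Finset.sum_nonneg fun k hk => hQ.nonneg i k (Finset.ne_of_mem_erase hk).symm

theorem mem_fastStates {S : Type*} [Fintype S] {Q : ℝ → Matrix S S ℝ} {i : S} :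
    i ∈ fastStates Q ↔ Tendsto (exitRate Q i) atTop atTop := by
  simp [fastStates]

theorem mem_slowStates {S : Type*} [Fintype S] {Q : ℝ → Matrix S S ℝ} {i : S} :
    i ∈ slowStates Q ↔ ∃ c : ℝ, Tendsto (exitRate Q i) atTop (𝓝 c) := by
  simp [slowStates]

variable {Q : ℝ → Matrix S S ℝ}

theorem IsTwoTimeScale.eventually_rate (hQ : IsTwoTimeScale Q) :
    ∀ᶠ l in atTop, IsRateMatrix (Q l) :=
  (eventually_gt_atTop 0).mono hQ.rate

/-- An exit rate is the sum of the off-diagonal rates: if these all have finite limits it converges,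
and otherwise it dominates one that diverges. -/
theorem IsTwoTimeScale.mem_slow_iff (hQ : IsTwoTimeScale Q) (i : S) :
    i ∈ slowStates Q ↔ i ∉ fastStates Q := by
  rw [mem_slowStates, mem_fastStates]
  constructor
  · rintro ⟨c, hc⟩ h
    exact not_tendsto_nhds_of_tendsto_atTop h c hc
  · intro h
    by_cases hfin : ∀ j, i ≠ j → ∃ c : ℝ, Tendsto (fun l => Q l i j) atTop (𝓝 c)
    · choose! c hc using hfin
      refine ⟨∑ j ∈ Finset.univ.erase i, c j, ?_⟩
      refine (tendsto_finsetSum _ fun j hj => hc j (Finset.ne_of_mem_erase hj).symm).congr' ?_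
      filter_upwards [hQ.eventually_rate] with l hl
      exact (hl.exitRate_eq_sum i).symm
    · push Not at hfin
      obtain ⟨j, hij, hj⟩ := hfin
      have h1 := (hQ.rate_limit i j hij).resolve_left fun ⟨c, hc⟩ => hj c hc
      refine absurd (tendsto_atTop_mono' _ ?_ h1) h
      filter_upwards [hQ.eventually_rate] with l hl
      exact hl.le_exitRate hij

theorem IsTwoTimeScale.tendsto_limRate (hQ : IsTwoTimeScale Q) {i : S} (hi : i ∈ slowStates Q)
    (j : S) : Tendsto (fun l => Q l i j) atTop (𝓝 (limRate Q i j)) := by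
  refine tendsto_nhds_limUnder ?_
  obtain ⟨c, hc⟩ := mem_slowStates.1 hi
  by_cases hij : i = j
  · subst hij
    exact ⟨-c, hc.neg.congr fun l => neg_neg _⟩
  · refine (hQ.rate_limit i j hij).resolve_right fun h => ?_
    refine not_tendsto_nhds_of_tendsto_atTop (tendsto_atTop_mono' _ ?_ h) c hc
    filter_upwards [hQ.eventually_rate] with l hl
    exact hl.le_exitRate hij

theorem IsTwoTimeScale.tendsto_limJump (hQ : IsTwoTimeScale Q) (i j : S) :
    Tendsto (fun l => jumpMatrix (Q l) i j) atTop (𝓝 (limJump Q i j)) := by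
  refine tendsto_nhds_limUnder ?_
  by_cases hij : i = j
  · exact ⟨0, by simp [jumpMatrix, hij]⟩
  · exact hQ.jump_limit i j hij

theorem IsTwoTimeScale.eventually_exitRate_pos (hQ : IsTwoTimeScale Q) (i : S) :
    ∀ᶠ l in atTop, 0 < -Q l i i := by
  by_cases hi : i ∈ slowStates Q
  · obtain ⟨c, hc⟩ := mem_slowStates.1 hi
    exact hc.eventually (lt_mem_nhds (hQ.slow_pos i hi c hc))
  · have := mem_fastStates.1 (not_not.1 fun h => hi ((hQ.mem_slow_iff i).2 h))
    exact this.eventually_gt_atTop 0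

theorem IsTwoTimeScale.limJump_nonneg (hQ : IsTwoTimeScale Q) (i j : S) : 0 ≤ limJump Q i j := by
  refine ge_of_tendsto (hQ.tendsto_limJump i j) ?_
  filter_upwards [hQ.eventually_rate] with l hl
  rw [jumpMatrix, of_apply]
  split_ifs with hij
  · exact le_rfl
  · exact div_nonneg (hl.nonneg i j hij) (hl.exitRate_nonneg i)

/-- Before the limit, rows of the jump matrix sum to one only where the exit rate is nonzero; on `B`
this uses the positivity of its limit. -/
theorem IsTwoTimeScale.limJump_row_sum (hQ : IsTwoTimeScale Q) (i : S) :
    ∑ j, limJump Q i j = 1 := by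
  refine tendsto_nhds_unique (tendsto_finsetSum _ fun j _ => hQ.tendsto_limJump i j)
    (tendsto_const_nhds.congr' ?_)
  filter_upwards [hQ.eventually_rate, hQ.eventually_exitRate_pos i] with l hl hpos
  have h := mulVec_eq_exitRate_mul (Q := Q l) (fun _ => 1) (i := i) (by linarith)
  rw [hl.mulVec_const, Pi.zero_apply, eq_comm, mul_eq_zero, or_iff_right hpos.ne'] at h
  simp only [mulVec, dotProduct, mul_one] at h
  linarith

theorem tendsto_nonsing_inv {ι n : Type*} [Fintype n] [DecidableEq n] {F : Filter ι}
    {f : ι → Matrix n n ℝ} {M : Matrix n n ℝ} (hf : Tendsto f F (𝓝 M)) (hM : M.det ≠ 0) :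
    Tendsto (fun x => (f x)⁻¹) F (𝓝 M⁻¹) := by
  simp only [Matrix.inv_def, Ring.inverse_eq_inv']
  exact (((continuous_id.matrix_det.tendsto M).comp hf).inv₀ hM).smul
    ((continuous_id.matrix_adjugate.tendsto M).comp hf)

theorem tendsto_matrix {ι m n : Type*} {F : Filter ι} {f : ι → Matrix m n ℝ} {M : Matrix m n ℝ} :
    Tendsto f F (𝓝 M) ↔ ∀ i j, Tendsto (fun x => f x i j) F (𝓝 (M i j)) :=
  tendsto_pi_nhds.trans (forall_congr' fun _ => tendsto_pi_nhds)

theorem tendsto_matrix_mul {ι m n k : Type*} [Fintype n] {F : Filter ι} {f : ι → Matrix m n ℝ}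
    {g : ι → Matrix n k ℝ} {M : Matrix m n ℝ} {N : Matrix n k ℝ} (hf : Tendsto f F (𝓝 M))
    (hg : Tendsto g F (𝓝 N)) : Tendsto (fun x => f x * g x) F (𝓝 (M * N)) :=
  tendsto_matrix.2 fun i j =>
    tendsto_finsetSum _ fun k _ => (tendsto_matrix.1 hf i k).mul (tendsto_matrix.1 hg k j)

theorem IsTwoTimeScale.tendsto_one_sub_jump (hQ : IsTwoTimeScale Q) (A : Finset S) :
    Tendsto (fun l => 1 - block (jumpMatrix (Q l)) A A) atTop (𝓝 (1 - block (limJump Q) A A)) :=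
  tendsto_matrix.2 fun i j => tendsto_const_nhds.sub (hQ.tendsto_limJump i j)

theorem IsTwoTimeScale.eventually_isUnit_det (hQ : IsTwoTimeScale Q)
    (hdet : (1 - block (limJump Q) (fastStates Q) (fastStates Q)).det ≠ 0) :
    ∀ᶠ l in atTop, IsUnit (1 - block (jumpMatrix (Q l)) (fastStates Q) (fastStates Q)).det := by
  have h := (continuous_id.matrix_det.tendsto _).comp (hQ.tendsto_one_sub_jump (fastStates Q))
  exact (h.eventually_ne hdet).mono fun l hl => isUnit_iff_ne_zero.2 hl

theorem IsTwoTimeScale.tendsto_exitProb (hQ : IsTwoTimeScale Q)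
    (hdet : (1 - block (limJump Q) (fastStates Q) (fastStates Q)).det ≠ 0) :
    Tendsto (fun l => exitProb (jumpMatrix (Q l)) (fastStates Q) (slowStates Q)) atTop
      (𝓝 (exitMatrix Q)) :=
  tendsto_matrix_mul (tendsto_nonsing_inv (hQ.tendsto_one_sub_jump _) hdet)
    (tendsto_matrix.2 fun i j => hQ.tendsto_limJump i j)

theorem IsTwoTimeScale.tendsto_extendByOne (hQ : IsTwoTimeScale Q)
    (hdet : (1 - block (limJump Q) (fastStates Q) (fastStates Q)).det ≠ 0) :
    Tendsto (fun l => extendByOne (exitProb (jumpMatrix (Q l)) (fastStates Q) (slowStates Q)))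
      atTop (𝓝 (extendByOne (exitMatrix Q))) := by
  refine tendsto_matrix.2 fun i b => ?_
  simp only [extendByOne, of_apply]
  split_ifs with hi h
  · exact tendsto_matrix.1 (hQ.tendsto_exitProb hdet) _ _
  all_goals exact tendsto_const_nhds

theorem IsTwoTimeScale.tendsto_effectiveRate (hQ : IsTwoTimeScale Q)
    (hdet : (1 - block (limJump Q) (fastStates Q) (fastStates Q)).det ≠ 0) :
    Tendsto (fun l => effectiveRate (Q l)
      (exitProb (jumpMatrix (Q l)) (fastStates Q) (slowStates Q))) atTop
      (𝓝 (reducedRate Q)) := by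
  refine Tendsto.add (tendsto_matrix.2 fun i j => hQ.tendsto_limRate i.2 j)
    (tendsto_matrix_mul (tendsto_matrix.2 fun i j => hQ.tendsto_limRate i.2 j)
      (hQ.tendsto_exitProb hdet))

/-- The inverse of `I - W_AA` converges, while the mean holding times it multiplies tend to 0. -/
theorem IsTwoTimeScale.tendsto_meanExitTime (hQ : IsTwoTimeScale Q)
    (hdet : (1 - block (limJump Q) (fastStates Q) (fastStates Q)).det ≠ 0) (i : S) :
    Tendsto (fun l => meanExitTime (Q l) (fastStates Q) i) atTop (𝓝 0) := by
  unfold meanExitTime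
  split_ifs with hi
  · have h := tendsto_matrix.1 (tendsto_nonsing_inv (hQ.tendsto_one_sub_jump _) hdet)
    have h2 := tendsto_finsetSum Finset.univ fun (a : fastStates Q) _ =>
      (h ⟨i, hi⟩ a).mul (mem_fastStates.1 a.2).inv_tendsto_atTop
    simp only [mul_zero, Finset.sum_const_zero] at h2
    exact h2
  · exact tendsto_const_nhds

theorem abs_mulVec_le {m n : Type*} [Fintype m] [Fintype n] (M : Matrix m n ℝ) {v : n → ℝ}
    {c : ℝ} (hv : ∀ j, |v j| ≤ c) (i : m) :
    |(M *ᵥ v) i| ≤ (∑ i, ∑ j, |M i j|) * c := by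
  by_cases hn : Nonempty n
  · have hc : 0 ≤ c := (abs_nonneg _).trans (hv hn.some)
    have h1 : |(M *ᵥ v) i| ≤ (∑ j, |M i j|) * c := by
      rw [Finset.sum_mul]
      refine (Finset.abs_sum_le_sum_abs _ _).trans (Finset.sum_le_sum fun j _ => ?_)
      rw [abs_mul]
      exact mul_le_mul_of_nonneg_left (hv j) (abs_nonneg _)
    refine h1.trans (mul_le_mul_of_nonneg_right ?_ hc)
    exact Finset.single_le_sum (f := fun i => ∑ j, |M i j|)
      (fun _ _ => Finset.sum_nonneg fun _ _ => abs_nonneg _) (Finset.mem_univ i)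
  · have : IsEmpty n := not_nonempty_iff.1 hn
    simp [mulVec, dotProduct]

theorem tendsto_sum_abs {ι m n : Type*} [Fintype m] [Fintype n] {F : Filter ι}
    {f : ι → Matrix m n ℝ} {M : Matrix m n ℝ} (hf : Tendsto f F (𝓝 M)) :
    Tendsto (fun x => ∑ i, ∑ j, |f x i j|) F (𝓝 (∑ i, ∑ j, |M i j|)) :=
  tendsto_finsetSum _ fun i _ => tendsto_finsetSum _ fun j _ => (tendsto_matrix.1 hf i j).abs

theorem exists_bound_exp_mulVec {n : Type*} [Fintype n] [DecidableEq n] (G : Matrix n n ℝ)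
    (g : n → ℝ) (T : ℝ) : ∃ m : ℝ, 0 ≤ m ∧ ∀ x, 0 ≤ x → x ≤ T →
      (∀ b, |(NormedSpace.exp (x • G) *ᵥ g) b| ≤ m) ∧
      ∀ b, |(G *ᵥ (NormedSpace.exp (x • G) *ᵥ g)) b| ≤ m := by
  have hc : Continuous fun x : ℝ => NormedSpace.exp (x • G) *ᵥ g := by
    refine continuous_pi fun b => ?_
    refine continuous_finsetSum _ fun c _ => Continuous.mul ?_ continuous_const
    exact continuous_iff_continuousAt.2 fun x => (hasDerivAt_exp_smul_apply G x b c).continuousAt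
  obtain ⟨m₁, h₁⟩ := (isCompact_Icc (a := (0 : ℝ)) (b := T)).exists_bound_of_continuousOn
    hc.continuousOn
  obtain ⟨m₂, h₂⟩ := (isCompact_Icc (a := (0 : ℝ)) (b := T)).exists_bound_of_continuousOn
    (continuous_const.matrix_mulVec hc : Continuous fun x : ℝ =>
      G *ᵥ (NormedSpace.exp (x • G) *ᵥ g)).continuousOn
  refine ⟨max 0 (max m₁ m₂), le_max_left _ _, fun x hx hxT => ⟨fun b => ?_, fun b => ?_⟩⟩
  · exact (norm_le_pi_norm _ b).trans
      ((h₁ x ⟨hx, hxT⟩).trans ((le_max_left _ _).trans (le_max_right _ _)))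
  · exact (norm_le_pi_norm _ b).trans
      ((h₂ x ⟨hx, hxT⟩).trans ((le_max_right _ _).trans (le_max_right _ _)))

/-- Convergence of the transition probabilities, uniformly on `[h, T]`. -/
theorem IsTwoTimeScale.eventually_abs_exp_sub_le (hQ : IsTwoTimeScale Q)
    (hdet : (1 - block (limJump Q) (fastStates Q) (fastStates Q)).det ≠ 0)
    {h T : ℝ} (hh : 0 < h) (j : S) {ε : ℝ}
    (hε : 0 < ε) : ∀ᶠ l in atTop, ∀ t, h ≤ t → t ≤ T → ∀ i,
      |(NormedSpace.exp (t • Q l) *ᵥ Pi.single j 1) i -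
        (extendByOne (exitMatrix Q) *ᵥ (NormedSpace.exp (t • reducedRate Q) *ᵥ
          fun b : slowStates Q => Pi.single (M := fun _ => ℝ) j 1 (b : S))) i| ≤ ε := by
  classical
  set A := fastStates Q
  set B := slowStates Q
  set f : S → ℝ := Pi.single j 1 with hf
  have hf1 : ∀ i, |f i| ≤ 1 := by
    intro i
    by_cases hij : i = j
    · subst hij; simp [hf]
    · simp [hf, hij]
  obtain ⟨m, hm0, hm⟩ := exists_bound_exp_mulVec (reducedRate Q) (fun b : B => f b) T
  set N' : ℝ → Matrix A B ℝ := fun l => exitProb (jumpMatrix (Q l)) A B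
  have hJ := tendsto_sum_abs (hQ.tendsto_extendByOne hdet)
  have hρ := (tendsto_sum_abs ((hQ.tendsto_extendByOne hdet).sub_const
    (extendByOne (exitMatrix Q)))).mul_const m
  have hr := (tendsto_sum_abs ((hQ.tendsto_effectiveRate hdet).const_sub
    (reducedRate Q))).mul_const m
  have hV := tendsto_finsetSum Finset.univ fun i _ => (hQ.tendsto_meanExitTime hdet i).abs
  have hd := tendsto_finsetSum Finset.univ fun (b : B) _ =>
    (tendsto_finsetSum Finset.univ fun (a : A) _ =>
      (hQ.tendsto_limRate b.2 a).mul (hQ.tendsto_meanExitTime hdet a)).abs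
  have hC := tendsto_finsetSum Finset.univ fun (b : B) _ => (hQ.tendsto_limRate b.2 b).abs
  simp only [sub_self, Matrix.zero_apply, abs_zero, Finset.sum_const_zero, zero_mul, mul_zero]
    at hρ hr hV hd
  set cJ : ℝ := ∑ i, ∑ b, |extendByOne (exitMatrix Q) i b|
  set cC : ℝ := ∑ b : B, |limRate Q b b|
  have hcJ : 0 ≤ cJ := Finset.sum_nonneg fun _ _ => Finset.sum_nonneg fun _ _ => abs_nonneg _
  have hcC : 0 ≤ cC := Finset.sum_nonneg fun _ _ => abs_nonneg _
  -- The part `(1 + cJ) * (s * cC)` of the bound does not vanish as `λ → ∞`, so the relaxation time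
  -- `s` is fixed first to make it less than `ε`.
  obtain ⟨s, hs0, hsh, hs⟩ : ∃ s, 0 < s ∧ s ≤ h ∧ (1 + cJ) * (s * cC) < ε := by
    have hcont : Tendsto (fun s : ℝ => (1 + cJ) * (s * cC)) (𝓝[>] 0) (𝓝 0) := by
      have : Tendsto (fun s : ℝ => (1 + cJ) * (s * cC)) (𝓝 0) (𝓝 ((1 + cJ) * (0 * cC))) :=
        (by fun_prop : Continuous fun s : ℝ => (1 + cJ) * (s * cC)).tendsto 0
      rw [zero_mul, mul_zero] at this
      exact this.mono_left nhdsWithin_le_nhds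
    obtain ⟨s, h1, h2⟩ := ((hcont.eventually (gt_mem_nhds hε)).and
      (Ioc_mem_nhdsGT hh)).exists
    exact ⟨s, h2.1, h2.2, h1⟩
  have htot := (((hJ.const_add 1).mul
    ((((hV.const_mul 2).div_const s).add hd).add (hC.const_mul s))).add
    (((((hJ.mul_const m).const_mul 2).mul hV).add
      ((((hJ.mul_const m).mul hd).add hr).mul_const T)))).add hρ
  simp only [mul_zero, zero_div, zero_add, zero_mul, add_zero] at htot
  filter_upwards [htot.eventually (gt_mem_nhds hs), hQ.eventually_rate,
    eventually_all.2 hQ.eventually_exitRate_pos, hQ.eventually_isUnit_det hdet]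
    with l hl hrate hpos hunit t hht htT i
  have ht0 : 0 ≤ t := hh.le.trans hht
  have hnn : 0 ≤ ∑ i, ∑ b, |extendByOne (N' l) i b| :=
    Finset.sum_nonneg fun _ _ => Finset.sum_nonneg fun _ _ => abs_nonneg _
  have hbound := abs_exp_sub_extendByOne_le hrate hQ.mem_slow_iff
    (fun i _ hi => by have := hpos i; rw [hi] at this; simp at this) hunit (N' := N' l) rfl
    (exitMatrix Q) (reducedRate Q) hs0 (hsh.trans hht)
    (e := ∑ i, |meanExitTime (Q l) A i|)
    (d := ∑ b : B, |∑ a : A, Q l b a * meanExitTime (Q l) A a|)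
    (r := (∑ b, ∑ c, |(reducedRate Q - effectiveRate (Q l) (N' l)) b c|) * m)
    (K := (∑ i, ∑ b, |extendByOne (N' l) i b|) * m)
    (K₁ := 1 + ∑ i, ∑ b, |extendByOne (N' l) i b|)
    (ρ := (∑ i, ∑ b, |(extendByOne (N' l) - extendByOne (exitMatrix Q)) i b|) * m)
    (fun i => Finset.single_le_sum (f := fun i => |meanExitTime (Q l) A i|)
      (fun _ _ => abs_nonneg _) (Finset.mem_univ i))
    (fun b => Finset.single_le_sum
      (f := fun b : B => |∑ a : A, Q l b a * meanExitTime (Q l) A a|)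
      (fun _ _ => abs_nonneg _) (Finset.mem_univ b))
    (Finset.sum_nonneg fun _ _ => abs_nonneg _) (mul_nonneg hnn hm0)
    (mul_nonneg (Finset.sum_nonneg fun _ _ => Finset.sum_nonneg fun _ _ => abs_nonneg _) hm0)
    (by linarith) f
    (fun x hx hxt i => abs_mulVec_le _ (hm x hx (hxt.trans htT)).2 i)
    (fun x hx hxt i => abs_mulVec_le _ (hm x hx (hxt.trans htT)).1 i)
    (fun i => (abs_sub _ _).trans (add_le_add (hf1 i)
      ((abs_mulVec_le (extendByOne (N' l)) (v := fun b => f b) (fun b => hf1 b) i).trans (mul_one _).le)))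
    (fun i => abs_mulVec_le _ (hm t ht0 htT).1 i) i
  refine (hbound.trans ?_).trans hl.le
  refine add_le_add (add_le_add le_rfl
    (add_le_add le_rfl (mul_le_mul_of_nonneg_left htT (add_nonneg ?_ ?_)))) le_rfl
  · exact mul_nonneg (mul_nonneg hnn hm0) (Finset.sum_nonneg fun _ _ => abs_nonneg _)
  · exact mul_nonneg
      (Finset.sum_nonneg fun _ _ => Finset.sum_nonneg fun _ _ => abs_nonneg _) hm0

end Limits

/-! ### Laws of the chains and invertibility of `I - Ω_AA`. -/

section Probability

open Matrix

theorem real_eq_sum_real_inter {E Ω : Type*} [Fintype E] [MeasurableSpace E]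
    [MeasurableSingletonClass E] [MeasurableSpace Ω] (P : Measure Ω) [IsFiniteMeasure P]
    {ξ : Ω → E} (hξ : Measurable ξ) {s : Set Ω} (hs : MeasurableSet s) :
    P.real s = ∑ i, P.real {ω | ξ ω = i ∧ ω ∈ s} := by
  have h := measureReal_biUnion_finset (μ := P) (s := (Finset.univ : Finset E))
    (f := fun i => {ω | ξ ω = i ∧ ω ∈ s})
    (fun i _ k _ hik => Set.disjoint_left.2 fun ω h1 h2 => hik (h1.1.symm.trans h2.1))
    (fun i _ => (hξ (measurableSet_singleton i)).inter hs)
  rw [← h]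
  congr 1
  ext ω
  simp

/-- Law of a continuous-time Markov chain at time `t`. -/
theorem IsMarkovChain.real_eq {E Ω : Type*} [Fintype E] [DecidableEq E] [MeasurableSpace E]
    [MeasurableSingletonClass E] [MeasurableSpace Ω] {Q : Matrix E E ℝ} {μ : E → ℝ}
    {X : ℝ≥0 → Ω → E} {P : Measure Ω} (hX : IsMarkovChain Q μ X P) (t : ℝ≥0) (j : E) :
    P.real {ω | X t ω = j} = (μ ᵥ* NormedSpace.exp ((t : ℝ) • Q)) j := by
  have := hX.isProb
  have hj : MeasurableSet {ω | X t ω = j} := hX.measurable t (measurableSet_singleton j)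
  rw [real_eq_sum_real_inter P (hX.measurable 0) hj]
  simp only [vecMul, dotProduct]
  refine Finset.sum_congr rfl fun i _ => ?_
  have h := hX.markov 0 (fun k => if k = 0 then 0 else t)
    (fun a b hab => by
      dsimp only
      split_ifs with h1 h2
      · exact le_rfl
      · exact zero_le
      · omega
      · exact le_rfl) (fun k => if k = 0 then i else j)
  simp only [zero_add, if_true, one_ne_zero, if_false, NNReal.coe_zero, sub_zero,
    Nat.le_zero, forall_eq] at h
  rw [hX.initial i] at h
  rw [← h]
  congr 1
  ext ω
  constructor
  · rintro ⟨h0, h1⟩ k hk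
    interval_cases k
    · simpa using h0
    · simpa using h1
  · intro hω
    exact ⟨by simpa using hω 0 zero_le_one, by simpa using hω 1 le_rfl⟩

theorem IsDiscreteMarkovChain.ae_ne_zero {E Ω : Type*} [Fintype E] [DecidableEq E]
    [MeasurableSpace E] [MeasurableSpace Ω] {W : Matrix E E ℝ}
    {μ : E → ℝ} {ξ : ℕ → Ω → E} {P : Measure Ω} (hξ : IsDiscreteMarkovChain W μ ξ P) :
    ∀ᵐ ω ∂P, ∀ n, W (ξ n ω) (ξ (n + 1) ω) ≠ 0 := by
  have := hξ.isProb
  refine ae_all_iff.2 fun n => ?_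
  have hnull : ∀ᵐ ω ∂P, ∀ σ : Fin (n + 2) → E,
      W (σ ⟨n, by omega⟩) (σ ⟨n + 1, by omega⟩) = 0 → ¬∀ k : Fin (n + 2), ξ k ω = σ k := by
    refine ae_all_iff.2 fun σ => ?_
    by_cases hσ : W (σ ⟨n, by omega⟩) (σ ⟨n + 1, by omega⟩) = 0
    · have h := hξ.markov n fun k => σ ⟨min k (n + 1), by omega⟩
      simp only [le_refl, min_eq_left, Nat.le_succ, hσ, mul_zero] at h
      have h0 := (measureReal_eq_zero_iff).1 h
      have : ∀ᵐ ω ∂P, ¬∀ k ≤ n + 1, ξ k ω = σ ⟨min k (n + 1), by omega⟩ := by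
        rw [ae_iff]
        simpa only [not_not] using h0
      filter_upwards [this] with ω hω _ hk
      refine hω fun k hk' => ?_
      have := hk ⟨k, by omega⟩
      simpa [min_eq_left hk'] using this
    · exact Eventually.of_forall fun ω h => absurd h hσ
  filter_upwards [hnull] with ω hω h0
  exact hω (fun k => ξ k ω) h0 fun k => rfl

theorem IsDiscreteMarkovChain.ae_initial {E Ω : Type*} [Fintype E] [DecidableEq E]
    [MeasurableSpace E] [MeasurableSingletonClass E] [MeasurableSpace Ω] {W : Matrix E E ℝ}
    {i : E} {ξ : ℕ → Ω → E} {P : Measure Ω}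
    (hξ : IsDiscreteMarkovChain W (Pi.single i 1) ξ P) : ∀ᵐ ω ∂P, ξ 0 ω = i := by
  have := hξ.isProb
  have h := hξ.initial i
  rw [Pi.single_eq_same] at h
  have hm : MeasurableSet {ω | ξ 0 ω = i} := hξ.measurable 0 (measurableSet_singleton i)
  have h2 := probReal_compl_eq_one_sub (μ := P) hm
  rw [h, sub_self] at h2
  exact (measureReal_eq_zero_iff).1 h2

/-- If the chain leaves `A` almost surely, then `1` is not an eigenvalue of the block of its
transition matrix on `A`. -/
theorem det_one_sub_block_ne_zero {S : Type*} [Fintype S] [DecidableEq S]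
    [MeasurableSpace S] [MeasurableSingletonClass S] {W : Matrix S S ℝ}
    (hW : ∀ i j, 0 ≤ W i j) (hsum : ∀ i, ∑ j, W i j = 1) {A B : Finset S}
    (hAB : ∀ i, i ∈ B ↔ i ∉ A) {Ω : Type*} [MeasurableSpace Ω]
    (ξ : ℕ → Ω → S) (P : S → Measure Ω)
    (hξ : ∀ i, IsDiscreteMarkovChain W (Pi.single i 1) ξ (P i))
    (hT : ∀ i ∈ A, P i {ω | hittingAfter ξ B 0 ω < ⊤} = 1) :
    (1 - block W A A).det ≠ 0 := by
  intro hdet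
  obtain ⟨v, hv0, hv⟩ := exists_mulVec_eq_zero_iff.2 hdet
  obtain ⟨a₁, ha₁⟩ := Function.ne_iff.1 hv0
  have : Nonempty A := ⟨a₁⟩
  obtain ⟨a, ha⟩ := Finite.exists_max fun a => |v a|
  set m := |v a|
  have hm : 0 < m := (abs_pos.2 ha₁).trans_le (ha a₁)
  -- The modulus of a null vector of `I - W_AA`, extended by zero, is subharmonic on `A` and has its
  -- maximum `m > 0` inside `A`.
  set z : S → ℝ := fun i => if hi : i ∈ A then |v ⟨i, hi⟩| else 0 with hz
  have hzA : ∀ a : A, z a = |v a| := fun a => by simp [hz]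
  have hzm : ∀ i, z i ≤ m := by
    intro i
    simp only [hz]
    split_ifs with hi
    · exact ha _
    · exact hm.le
  -- Maximum principle: where `z = m`, the value `m` is at most an average of values `≤ m`, so `z =
  -- m` at every state reachable in one step. A chain started at the maximizer therefore never
  -- leaves `A`.
  have hclosed : ∀ i j, z i = m → W i j ≠ 0 → z j = m := by
    intro i j hi hij
    have hiA : i ∈ A := by
      by_contra h
      simp only [hz, h, dif_neg, not_false_eq_true] at hi
      exact hm.ne hi
    have h1 : v ⟨i, hiA⟩ = ∑ k : A, W i k * v k := by
      have h := congrFun hv ⟨i, hiA⟩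
      rw [sub_mulVec, one_mulVec, Pi.sub_apply, Pi.zero_apply, sub_eq_zero] at h
      exact h
    have h2 : m ≤ ∑ k, W i k * z k := by
      rw [sum_eq_sum_add_sum hAB]
      calc m = |v ⟨i, hiA⟩| := by rw [← hi, ← hzA]
        _ ≤ ∑ k : A, W i k * z k := by
          rw [h1]
          refine (Finset.abs_sum_le_sum_abs _ _).trans (Finset.sum_le_sum fun k _ => ?_)
          rw [abs_mul, abs_of_nonneg (hW _ _), hzA]
        _ ≤ _ := by
          refine le_add_of_nonneg_right (Finset.sum_nonneg fun b _ => ?_)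
          simp [hz, (hAB b).1 b.2]
    have hnn : ∀ k ∈ Finset.univ, 0 ≤ W i k * (m - z k) := fun k _ =>
      mul_nonneg (hW i k) (sub_nonneg.2 (hzm k))
    have h3 : ∑ k, W i k * (m - z k) = 0 := by
      refine le_antisymm ?_ (Finset.sum_nonneg hnn)
      simp only [mul_sub, Finset.sum_sub_distrib]
      rw [← Finset.sum_mul, hsum, one_mul]
      linarith
    have h4 := (Finset.sum_eq_zero_iff_of_nonneg hnn).1 h3 j (Finset.mem_univ j)
    linarith [(mul_eq_zero.1 h4).resolve_left hij]
  have hae : ∀ᵐ ω ∂P a, ¬hittingAfter ξ B 0 ω < ⊤ := by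
    filter_upwards [(hξ a).ae_ne_zero, (hξ a).ae_initial] with ω hω h0
    have hstay : ∀ n, z (ξ n ω) = m := by
      intro n
      induction n with
      | zero => rw [h0, hzA]
      | succ n ih => exact hclosed _ _ ih (hω n)
    rw [not_lt_top_iff, hittingAfter_eq_top_iff]
    intro n _ hn
    have h := hstay n
    simp only [hz, (hAB _).1 hn, dif_neg, not_false_eq_true] at h
    exact hm.ne h
  rw [ae_iff] at hae
  simp only [not_not] at hae
  rw [hT a a.2] at hae
  exact one_ne_zero hae

/-- Moves the extension operator from the function to the initial law, so the law of `Y` becomes a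
pairing of `p` with the approximating function. -/
theorem reducedInit_eq_vecMul {S : Type*} [Fintype S] [DecidableEq S] {Q : ℝ → Matrix S S ℝ}
    (hQ : IsTwoTimeScale Q) (p : S → ℝ) :
    reducedInit Q p = p ᵥ* extendByOne (exitMatrix Q) := by
  ext b
  rw [vecMul, dotProduct, sum_eq_sum_add_sum hQ.mem_slow_iff, reducedInit, Pi.add_apply, add_comm]
  congr 1
  · simp [vecMul, dotProduct, extendByOne]
  · simp [extendByOne, (hQ.mem_slow_iff _).1]

theorem abs_dotProduct_le_of_mem_stdSimplex {S : Type*} [Fintype S] {p : S → ℝ}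
    (hp : p ∈ stdSimplex ℝ S) {v : S → ℝ} {c : ℝ} (hv : ∀ i, |v i| ≤ c) :
    |p ⬝ᵥ v| ≤ c := by
  calc |p ⬝ᵥ v| ≤ ∑ i, |p i * v i| := Finset.abs_sum_le_sum_abs _ _
    _ ≤ ∑ i, p i * c := Finset.sum_le_sum fun i _ => by
      rw [abs_mul, abs_of_nonneg (hp.1 i)]
      exact mul_le_mul_of_nonneg_left (hv i) (hp.1 i)
    _ = c := by rw [← Finset.sum_mul, hp.2, one_mul]

theorem IsMarkovChain.map_real_singleton {S Ω : Type*} [Fintype S] [DecidableEq S]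
    [MeasurableSpace S] [MeasurableSingletonClass S] [MeasurableSpace Ω] {Q : Matrix S S ℝ}
    {p : S → ℝ} {X : ℝ≥0 → Ω → S} {P : Measure Ω} (hX : IsMarkovChain Q p X P) (t : ℝ≥0) (j : S) :
    (P.map (X t)).real {j} = p ⬝ᵥ (NormedSpace.exp ((t : ℝ) • Q) *ᵥ Pi.single j 1) := by
  rw [map_measureReal_apply (hX.measurable t) (measurableSet_singleton j), dotProduct_mulVec,
    dotProduct_single, mul_one]
  exact hX.real_eq t j

theorem IsMarkovChain.map_coe_real_singleton {S Ω : Type*} [Fintype S] [DecidableEq S]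
    [MeasurableSpace S] [MeasurableSingletonClass S] [MeasurableSpace Ω] {B : Finset S}
    {G : Matrix B B ℝ} {μ : B → ℝ} {Y : ℝ≥0 → Ω → B} {P : Measure Ω}
    (hY : IsMarkovChain G μ Y P) (t : ℝ≥0) (j : S) :
    (P.map fun ω => (Y t ω : S)).real {j} =
      μ ⬝ᵥ (NormedSpace.exp ((t : ℝ) • G) *ᵥ
        fun b : B => Pi.single (M := fun _ => ℝ) j 1 (b : S)) := by
  have hm : Measurable fun ω => (Y t ω : S) := measurable_subtype_coe.comp (hY.measurable t)
  rw [map_measureReal_apply hm (measurableSet_singleton j), dotProduct_mulVec]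
  by_cases hj : j ∈ B
  · have h1 : (fun b : B => Pi.single (M := fun _ => ℝ) j 1 (b : S)) =
        Pi.single (⟨j, hj⟩ : B) 1 := by
      ext b
      simp [Pi.single_apply, Subtype.ext_iff]
    rw [h1, dotProduct_single, mul_one, ← hY.real_eq]
    congr 1
    ext ω
    simp [Subtype.ext_iff]
  · have h1 : (fun b : B => Pi.single (M := fun _ => ℝ) j 1 (b : S)) = 0 := by
      ext b
      have : (b : S) ≠ j := fun h => hj (h ▸ b.2)
      simp [this]
    have h2 : (fun ω => (Y t ω : S)) ⁻¹' {j} = ∅ := by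
      ext ω
      simp only [Set.mem_preimage, Set.mem_singleton_iff, Set.mem_empty_iff_false, iff_false]
      exact fun h => hj (h ▸ (Y t ω).2)
    rw [h1, h2, dotProduct_zero, measureReal_empty]

end Probability

end TwoTimeScale

/-! ### Convergence in total variation. -/

open TwoTimeScale in
theorem theorem5 {S : Type*} [Fintype S] [DecidableEq S]
    [MeasurableSpace S] [MeasurableSingletonClass S]
    -- the family of transition rate matrices
    (Q : ℝ → Matrix S S ℝ) (hQ : IsTwoTimeScale Q)
    -- the chain with the limiting jump matrix, started at each state, reaches the slow states
    -- almost surely from every fast state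
    {Ω₀ : Type*} [MeasurableSpace Ω₀] (η : ℕ → Ω₀ → S) (P₀ : S → Measure Ω₀)
    (hη : ∀ i, IsDiscreteMarkovChain (limJump Q) (Pi.single i 1) η (P₀ i))
    (hT : ∀ i ∈ fastStates Q, P₀ i {ω | hittingAfter η (slowStates Q) 0 ω < ⊤} = 1)
    -- the initial distribution
    (p : S → ℝ) (hp : p ∈ stdSimplex ℝ S)
    -- for each value of the parameter, the original chain
    {Ω₁ : ℝ → Type*} [∀ l, MeasurableSpace (Ω₁ l)]
    (X : ∀ l, ℝ≥0 → Ω₁ l → S) (P : ∀ l, Measure (Ω₁ l))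
    (hX : ∀ l, 0 < l → IsMarkovChain (Q l) p (X l) (P l))
    -- the reduced chain started from the reduced distribution
    {Ω₂ : Type*} [MeasurableSpace Ω₂] (Y : ℝ≥0 → Ω₂ → slowStates Q) (P' : Measure Ω₂)
    (hY : IsMarkovChain (reducedRate Q) (reducedInit Q p) Y P')
    (h T : ℝ≥0) (hh : 0 < h) (hhT : h < T) :
    Tendsto
      (fun l : ℝ => ⨆ t : Set.Icc h T,
        tvDist ((P l).map (X l t)) (P'.map fun ω => (Y t ω : S)))
      atTop (𝓝 0) := by
  have hdet := det_one_sub_block_ne_zero hQ.limJump_nonneg hQ.limJump_row_sum hQ.mem_slow_iff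
    η P₀ hη hT
  have hnn : ∀ l (t : Set.Icc h T),
      0 ≤ tvDist ((P l).map (X l t)) (P'.map fun ω => (Y t ω : S)) := fun l t =>
    mul_nonneg (by norm_num) (Finset.sum_nonneg fun _ _ => abs_nonneg _)
  rw [Metric.tendsto_nhds]
  intro ε hε
  -- Each state contributes at most `δ` to the sum; the `+ 1` makes the denominator positive without
  -- a separate argument.
  set δ : ℝ := ε / (Fintype.card S + 1) with hδ
  have hδ0 : 0 < δ := by positivity
  filter_upwards [eventually_gt_atTop 0,
    eventually_all.2 fun j => hQ.eventually_abs_exp_sub_le hdet (h := h) (T := T)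
      (NNReal.coe_pos.2 hh) j hδ0] with l hl hbound
  rw [Real.dist_0_eq_abs, abs_of_nonneg (Real.iSup_nonneg (hnn l))]
  have : Nonempty (Set.Icc h T) := ⟨⟨h, le_rfl, hhT.le⟩⟩
  refine lt_of_le_of_lt (b := 1 / 2 * (Fintype.card S * δ)) (ciSup_le fun t => ?_) ?_
  · refine mul_le_mul_of_nonneg_left ?_ (by norm_num)
    rw [← nsmul_eq_mul, ← Finset.card_univ]
    refine Finset.sum_le_card_nsmul _ _ _ fun j _ => ?_
    rw [(hX l hl).map_real_singleton, hY.map_coe_real_singleton, reducedInit_eq_vecMul hQ,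
      ← Matrix.dotProduct_mulVec, ← dotProduct_sub]
    exact abs_dotProduct_le_of_mem_stdSimplex hp fun i =>
      hbound j t (NNReal.coe_le_coe.2 t.2.1) (NNReal.coe_le_coe.2 t.2.2) i
  · have h1 : (Fintype.card S + 1) * δ = ε := by
      rw [hδ]; field_simp
    have h2 : 0 ≤ (Fintype.card S : ℝ) * δ := by positivity
    linarith
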